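/- Let $K$ be any field and let $n\ge 2$ be an integer. Let $C_K(n)$ be the unital associative $K$-algebra with generators $x_1,\dots,x_n,y_1,\dots,y_n$ and relations $y_ix_j=\delta_{ij}1$ for $1\le i,j\le n$, and let $L_K(n)$ be the Leavitt algebra of order $n$, i.e. the quotient of $C_K(n)$ by the two-sided ideal generated by $1-\sum_{i=1}^n x_iy_i$. Let $L_K(n)^-$ denote $L_K(n)$ regarded as a Lie algebra over $K$ with bracket $[a,b]=ab-ba$, and let $[L_K(n)^-,L_K(n)^-]$ be its Lie subalgebra consisting of all finite sums of elements $[a,b]$ with $a,b\in L_K(n)$. A Lie algebra $\mathfrak L$ over $K$ is called simple if $[\mathfrak L,\mathfrak L]\ne\{0\}$ and its only ideals are $\{0\}$ and $\mathfrak L$. Then the Lie algebra $[L_K(n)^-,L_K(n)^-]$ is simple if and only if $\operatorname{char}(K)$ divides $n-1$. (If $\operatorname{char}(K)=0$, divisibility means $n-1=0$, so in that case the Lie algebra is never simple.) -/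

import Mathlib

/-- Generators of the Cohn and Leavitt algebras of order `n`: `x i` and `y i` for `i : Fin n`. -/
inductive CohnGen (n : ℕ) : Type
  | x (i : Fin n)
  | y (i : Fin n)

/-- Defining relations of the Cohn algebra: `y i * x j = δ i j`. -/
inductive CohnRel (K : Type*) [Field K] (n : ℕ) :
    FreeAlgebra K (CohnGen n) → FreeAlgebra K (CohnGen n) → Prop
  | same (i : Fin n) :
      CohnRel K n (FreeAlgebra.ι K (CohnGen.y i) * FreeAlgebra.ι K (CohnGen.x i)) 1
  | diff (i j : Fin n) (hij : i ≠ j) :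
      CohnRel K n (FreeAlgebra.ι K (CohnGen.y i) * FreeAlgebra.ι K (CohnGen.x j)) 0

/-- The Cohn `K`-algebra of order `n`: the unital associative `K`-algebra presented by the
generators `x i`, `y i` and the relations `y i * x j = δ i j`. -/
abbrev CohnAlgebra (K : Type*) [Field K] (n : ℕ) : Type _ := RingQuot (CohnRel K n)

namespace CohnAlgebra

/-- The generator `x i` of the Cohn algebra. -/
noncomputable def x (K : Type*) [Field K] {n : ℕ} (i : Fin n) : CohnAlgebra K n :=
  RingQuot.mkAlgHom K (CohnRel K n) (FreeAlgebra.ι K (CohnGen.x i))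

/-- The generator `y i` of the Cohn algebra. -/
noncomputable def y (K : Type*) [Field K] {n : ℕ} (i : Fin n) : CohnAlgebra K n :=
  RingQuot.mkAlgHom K (CohnRel K n) (FreeAlgebra.ι K (CohnGen.y i))

end CohnAlgebra

/-- The single relation `1 - ∑ i, x i * y i = 0` imposed on the Cohn algebra. -/
inductive LeavittRel (K : Type*) [Field K] (n : ℕ) : CohnAlgebra K n → CohnAlgebra K n → Prop
  | unit : LeavittRel K n (1 - ∑ i : Fin n, CohnAlgebra.x K i * CohnAlgebra.y K i) 0

/-- The Leavitt `K`-algebra of order `n`: the quotient of the Cohn algebra by the two-sided ideal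
generated by `1 - ∑ i, x i * y i` (`RingQuot r` is the quotient by the two-sided ideal generated
by all differences `a - b` with `r a b`). -/
abbrev LeavittAlgebra (K : Type*) [Field K] (n : ℕ) : Type _ := RingQuot (LeavittRel K n)

/-- The Lie ring structure on the Leavitt algebra given by the commutator
`⁅a, b⁆ = a * b - b * a`. -/
instance LeavittAlgebra.instLieRing (K : Type*) [Field K] (n : ℕ) :
    LieRing (LeavittAlgebra K n) :=
  LieRing.ofAssociativeRing

/-- The Leavitt algebra as a Lie algebra over `K` under the commutator bracket. -/
noncomputable instance LeavittAlgebra.instLieAlgebra (K : Type*) [Field K] (n : ℕ) :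
    LieAlgebra K (LeavittAlgebra K n) :=
  LieAlgebra.ofAssociativeAlgebra

/-- The Lie algebra `[L, L]`, for `L` the Leavitt algebra under the commutator bracket: all finite
sums of brackets of elements of `L`, with the bracket restricted from `L`. -/
noncomputable abbrev LeavittAlgebra.derivedLie (K : Type*) [Field K] (n : ℕ) :
    LieIdeal K (LeavittAlgebra K n) :=
  ⁅(⊤ : LieIdeal K (LeavittAlgebra K n)), (⊤ : LieIdeal K (LeavittAlgebra K n))⁆

/-!
Let `L` be the Leavitt algebra and `S = [L, L]`. The theorem comes from two facts: `S` is simple if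
and only if `1 ∉ S`, and `1 ∈ S` if and only if `n - 1` is invertible in `K`.

Summing the commutators `[y i, x i]` gives `n - 1`, so `1 ∈ S` if `n - 1 ≠ 0` in `K`; then `S` has a
nonzero centre and is not simple (`LeavittAlgebra.one_mem_derivedLie`).

If `n = 1` in `K`, there is a trace. The Cohn algebra has the basis of monomials `x_I y_J`, and the
functional that is `1` on diagonal monomials and `0` on the others vanishes on commutators
(`CohnAlgebra.cohnTrace_mul_comm`). Passing from `x_I y_J` to `∑ i, x_I x_i y_i y_J` multiplies the
number of diagonal monomials by `n = 1`, so the functional vanishes on the kernel of the projection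
to `L` (`LeavittAlgebra.cohnTrace_eq_zero`), and `1 ∉ S`.

Assume `1 ∉ S` and let `U ≠ 0` be an ideal of `S`. The products `x i * r * y j`, with `x`, `y` the
words of length two, behave as the matrices with a single entry `r`; off the diagonal they lie in
`S`, and together with their brackets they span `S`. If some element of `U` has a nonzero
off-diagonal entry, brackets with matrix units move all multiples of this entry to all off-diagonal
positions, so `U = S`, because `L` is purely infinite simple
(`IsLeavittFamily.exists_mul_mul_eq_one`). If all elements of `U` are diagonal, they are central,
hence scalars (`IsLeavittFamily.exists_eq_algebraMap_of_central`), against `1 ∉ S`. This is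
`IsLeavittFamily.commutatorSpan_le_of_lieIdeal`; brackets of two different matrix units replace
squares of inner derivations, so that characteristic two needs no separate treatment.

Simplicity and the computation of the centre rest on compression: multiplying a polynomial in the
`x i` on the left by `y o' * y o ^ d` and on the right by `x o ^ e * x o'` leaves a scalar when `d`
bounds the degree, and leaves the constant term when moreover `e = d`.
-/

/-! ### Leavitt families and polynomials in the `x i` -/

/-- Families `x`, `y` in a ring satisfying the defining relations of the Leavitt algebra:
`y i * x j = δ i j` and `∑ i, x i * y i = 1`. -/
structure IsLeavittFamily {ι A : Type*} [Fintype ι] [DecidableEq ι] [Ring A]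
    (x y : ι → A) : Prop where
  y_mul_x : ∀ i j, y i * x j = if i = j then 1 else 0
  sum_x_mul_y : ∑ i, x i * y i = 1

namespace IsLeavittFamily

section Poly

variable (K : Type*) {ι A : Type*} [Field K] [Ring A] [Algebra K A]

/-- `IsPoly K y d p` says that `p` is a `K`-linear combination of products of at most `d` of the
`x i`. Since `p - c = ∑ i, x i * (y i * (p - c))`, this is encoded recursively: after a constant
term `c` is removed, every `y i * (p - c)` has degree at most `d - 1`. -/
def IsPoly (y : ι → A) : ℕ → A → Prop
  | 0, p => ∃ c : K, p = algebraMap K A c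
  | d + 1, p => ∃ c : K, ∀ i, IsPoly y d (y i * (p - algebraMap K A c))

/-- `IsPolyAfter K x y k a` says that `a` becomes a polynomial in the `x i` when multiplied on the
right by any product of `k` of the `x i`. -/
def IsPolyAfter (x y : ι → A) : ℕ → A → Prop
  | 0, a => ∃ d, IsPoly K y d a
  | k + 1, a => ∀ i, IsPolyAfter x y k (a * x i)

variable {K} {x y : ι → A}

theorem isPoly_algebraMap (d : ℕ) (c : K) : IsPoly K y d (algebraMap K A c) := by
  induction d generalizing c with
  | zero => exact ⟨c, rfl⟩
  | succ d ih => exact ⟨c, fun i => by simpa using ih 0⟩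

theorem isPoly_zero (d : ℕ) : IsPoly K y d (0 : A) := by
  simpa using isPoly_algebraMap (K := K) (y := y) d 0

theorem isPoly_ite [DecidableEq ι] (d : ℕ) (i j : ι) {p : A} (hp : IsPoly K y d p) :
    IsPoly K y d (if i = j then p else 0) := by
  split_ifs
  exacts [hp, isPoly_zero d]

theorem IsPoly.succ {d : ℕ} {p : A} (hp : IsPoly K y d p) : IsPoly K y (d + 1) p := by
  induction d generalizing p with
  | zero => obtain ⟨c, rfl⟩ := hp; exact isPoly_algebraMap _ c
  | succ d ih => obtain ⟨c, hc⟩ := hp; exact ⟨c, fun i => ih (hc i)⟩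

theorem IsPoly.add_right {d : ℕ} {p : A} (hp : IsPoly K y d p) (k : ℕ) :
    IsPoly K y (d + k) p := by
  induction k with
  | zero => exact hp
  | succ k ih => exact ih.succ

theorem IsPoly.mono {d e : ℕ} {p : A} (hp : IsPoly K y d p) (h : d ≤ e) : IsPoly K y e p := by
  obtain ⟨k, rfl⟩ := Nat.exists_eq_add_of_le h
  exact hp.add_right k

theorem IsPoly.add {d : ℕ} {p q : A} (hp : IsPoly K y d p) (hq : IsPoly K y d q) :
    IsPoly K y d (p + q) := by
  induction d generalizing p q with
  | zero =>
    obtain ⟨c, rfl⟩ := hp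
    obtain ⟨c', rfl⟩ := hq
    exact ⟨c + c', by simp⟩
  | succ d ih =>
    obtain ⟨c, hc⟩ := hp
    obtain ⟨c', hc'⟩ := hq
    refine ⟨c + c', fun i => ?_⟩
    convert ih (hc i) (hc' i) using 1
    rw [map_add]
    noncomm_ring

theorem IsPoly.algebraMap_mul {d : ℕ} {p : A} (hp : IsPoly K y d p) (r : K) :
    IsPoly K y d (algebraMap K A r * p) := by
  induction d generalizing p with
  | zero =>
    obtain ⟨c, rfl⟩ := hp
    exact ⟨r * c, by simp⟩
  | succ d ih =>
    obtain ⟨c, hc⟩ := hp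
    refine ⟨r * c, fun i => ?_⟩
    convert ih (hc i) using 1
    rw [map_mul, ← mul_sub, ← mul_assoc, ← mul_assoc, Algebra.commutes]

theorem IsPolyAfter.succ_of_mul_x (h : ∀ {d : ℕ} {p : A} (j : ι), IsPoly K y d p →
    IsPoly K y (d + 1) (p * x j)) {k : ℕ} {a : A} (ha : IsPolyAfter K x y k a) :
    IsPolyAfter K x y (k + 1) a := by
  induction k generalizing a with
  | zero => obtain ⟨d, hd⟩ := ha; exact fun i => ⟨d + 1, h i hd⟩
  | succ k ih => exact fun i => ih (ha i)

theorem IsPolyAfter.add {k : ℕ} {a b : A} (ha : IsPolyAfter K x y k a)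
    (hb : IsPolyAfter K x y k b) : IsPolyAfter K x y k (a + b) := by
  induction k generalizing a b with
  | zero =>
    obtain ⟨d, hd⟩ := ha
    obtain ⟨e, he⟩ := hb
    exact ⟨max d e, (hd.mono (le_max_left _ _)).add (he.mono (le_max_right _ _))⟩
  | succ k ih => intro i; rw [add_mul]; exact ih (ha i) (hb i)

theorem IsPolyAfter.algebraMap_mul {k : ℕ} {a : A} (ha : IsPolyAfter K x y k a) (r : K) :
    IsPolyAfter K x y k (algebraMap K A r * a) := by
  induction k generalizing a with
  | zero => obtain ⟨d, hd⟩ := ha; exact ⟨d, hd.algebraMap_mul r⟩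
  | succ k ih => intro i; rw [mul_assoc]; exact ih (ha i)

theorem IsPolyAfter.mul_x_pow {k : ℕ} {a : A} (ha : IsPolyAfter K x y k a) (i : ι) :
    ∃ d, IsPoly K y d (a * x i ^ k) := by
  induction k generalizing a with
  | zero => obtain ⟨d, hd⟩ := ha; exact ⟨d, by simpa using hd⟩
  | succ k ih => simpa [pow_succ', mul_assoc] using ih (ha i)

variable [Fintype ι] [DecidableEq ι] (h : IsLeavittFamily x y)
include h

theorem mul_x_isPoly {d : ℕ} {p : A} (j : ι) (hp : IsPoly K y d p) :
    IsPoly K y (d + 1) (p * x j) := by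
  have hconst (d : ℕ) (c : K) (i : ι) : IsPoly K y d (y i * (algebraMap K A c * x j)) := by
    rw [← mul_assoc, ← Algebra.commutes, mul_assoc, h.y_mul_x]
    simpa using isPoly_ite d i j (isPoly_algebraMap d c)
  induction d generalizing p with
  | zero =>
    obtain ⟨c, rfl⟩ := hp
    exact ⟨0, fun i => by simpa using hconst 0 c i⟩
  | succ d ih =>
    obtain ⟨c, hc⟩ := hp
    refine ⟨0, fun i => ?_⟩
    convert (ih (hc i)).add (hconst (d + 1) c i) using 1
    rw [map_zero]
    noncomm_ring

theorem x_mul_isPoly {d : ℕ} {p : A} (j : ι) (hp : IsPoly K y d p) :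
    IsPoly K y (d + 1) (x j * p) := by
  refine ⟨0, fun i => ?_⟩
  rw [map_zero, sub_zero, ← mul_assoc, h.y_mul_x, ite_mul, one_mul, zero_mul]
  exact isPoly_ite d i j hp

theorem isPolyAfter_mono {k l : ℕ} {a : A} (ha : IsPolyAfter K x y k a) (hkl : k ≤ l) :
    IsPolyAfter K x y l a := by
  induction hkl with
  | refl => exact ha
  | step _ ih => exact ih.succ_of_mul_x fun j hp => h.mul_x_isPoly j hp

theorem x_mul_isPolyAfter {k : ℕ} {a : A} (j : ι) (ha : IsPolyAfter K x y k a) :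
    IsPolyAfter K x y k (x j * a) := by
  induction k generalizing a with
  | zero => obtain ⟨d, hd⟩ := ha; exact ⟨d + 1, h.x_mul_isPoly j hd⟩
  | succ k ih => intro i; rw [mul_assoc]; exact ih (ha i)

theorem y_mul_isPolyAfter {k : ℕ} {a : A} (j : ι) (ha : IsPolyAfter K x y k a) :
    IsPolyAfter K x y (k + 1) (y j * a) := by
  induction k generalizing a with
  | zero =>
    obtain ⟨d, hd⟩ := ha
    obtain ⟨c, hc⟩ := hd.succ
    intro i
    refine ⟨d + 1, ?_⟩
    convert (h.mul_x_isPoly i (hc j)).add (isPoly_ite (d + 1) j i (isPoly_algebraMap (d + 1) c))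
      using 1
    have : y j * algebraMap K A c * x i = if j = i then algebraMap K A c else 0 := by
      rw [← Algebra.commutes, mul_assoc, h.y_mul_x]
      simp
    rw [← this]
    noncomm_ring
  | succ k ih => intro i; rw [mul_assoc]; exact ih (ha i)

/-- Every element becomes a polynomial in the `x i` after multiplication on the right by all
sufficiently long products of the `x i`: the elements with this property form a left ideal that
contains `1`. -/
theorem exists_isPolyAfter (hgen : Algebra.adjoin K (Set.range x ∪ Set.range y) = ⊤) (a : A) :
    ∃ k, IsPolyAfter K x y k a := by
  have ha : a ∈ Algebra.adjoin K (Set.range x ∪ Set.range y) := hgen ▸ Algebra.mem_top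
  suffices H : ∀ b : A, (∃ k, IsPolyAfter K x y k b) → ∃ k, IsPolyAfter K x y k (a * b) by
    simpa using H 1 ⟨0, 0, 1, by simp⟩
  induction ha using Algebra.adjoin_induction with
  | mem a ha =>
    rintro b ⟨k, hk⟩
    rcases ha with ⟨i, rfl⟩ | ⟨i, rfl⟩
    · exact ⟨k, h.x_mul_isPolyAfter i hk⟩
    · exact ⟨k + 1, h.y_mul_isPolyAfter i hk⟩
  | algebraMap r => rintro b ⟨k, hk⟩; exact ⟨k, hk.algebraMap_mul r⟩
  | add a a' _ _ iha iha' =>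
    intro b hb
    obtain ⟨k, hk⟩ := iha b hb
    obtain ⟨l, hl⟩ := iha' b hb
    rw [add_mul]
    exact ⟨max k l, (h.isPolyAfter_mono hk (le_max_left _ _)).add
      (h.isPolyAfter_mono hl (le_max_right _ _))⟩
  | mul a a' _ _ iha iha' =>
    intro b hb
    rw [mul_assoc]
    exact iha _ (iha' b hb)

theorem eq_sum_mul (a : A) : a = ∑ i, x i * (y i * a) := by
  simp only [← mul_assoc, ← Finset.sum_mul, h.sum_x_mul_y, one_mul]

theorem eq_zero_of_y_mul {a : A} (ha : ∀ i, y i * a = 0) : a = 0 := by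
  rw [h.eq_sum_mul a]
  simp [ha]

theorem eq_zero_of_mul_x {a : A} (ha : ∀ i, a * x i = 0) : a = 0 := by
  rw [← mul_one a, ← h.sum_x_mul_y, Finset.mul_sum]
  simp [← mul_assoc, ha]

/-! ### Compression by the words `x o ^ d * x o'` -/

/-- The words `x o ^ d * x o'` for different `d` are orthogonal, since none is a prefix of
another. -/
theorem y_mul_pow_mul_pow_mul_x {o o' : ι} (ho : o ≠ o') (d e : ℕ) :
    y o' * y o ^ d * (x o ^ e * x o') = if d = e then 1 else 0 := by
  induction d generalizing e with
  | zero =>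
    cases e with
    | zero => simp [h.y_mul_x]
    | succ e => simp [pow_succ', ← mul_assoc, h.y_mul_x, ho.symm]
  | succ d ih =>
    cases e with
    | zero => simp [pow_succ, mul_assoc, h.y_mul_x, ho]
    | succ e =>
      have : y o' * y o ^ (d + 1) * (x o ^ (e + 1) * x o') =
          y o' * y o ^ d * (y o * x o) * (x o ^ e * x o') := by
        rw [pow_succ, pow_succ']; noncomm_ring
      rw [this, h.y_mul_x, if_pos rfl, mul_one, ih]
      simp

/-- Splitting off the constant term `c` of `p` in a compression. -/
theorem compress_succ {o o' : ι} (ho : o ≠ o') (d e : ℕ) (p : A) (c : K) :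
    y o' * y o ^ (d + 1) * p * (x o ^ e * x o') =
      y o' * y o ^ d * (y o * (p - algebraMap K A c)) * (x o ^ e * x o') +
        if d + 1 = e then algebraMap K A c else 0 := by
  have : (if d + 1 = e then algebraMap K A c else 0) =
      y o' * y o ^ (d + 1) * algebraMap K A c * (x o ^ e * x o') := by
    rw [← Algebra.commutes, mul_assoc, h.y_mul_pow_mul_pow_mul_x ho]
    simp
  rw [this, pow_succ]
  noncomm_ring

/-- Compressing a polynomial of degree at most `d` on the left by the word `x o ^ d * x o'`
leaves a scalar. -/
theorem compress_isPoly {o o' : ι} (ho : o ≠ o') {d : ℕ} {p : A} (hp : IsPoly K y d p) (e : ℕ) :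
    ∃ c : K, y o' * y o ^ d * p * (x o ^ e * x o') = algebraMap K A c := by
  induction d generalizing p with
  | zero =>
    obtain ⟨c, rfl⟩ := hp
    refine ⟨if 0 = e then c else 0, ?_⟩
    rw [← Algebra.commutes, mul_assoc, h.y_mul_pow_mul_pow_mul_x ho]
    split_ifs <;> simp
  | succ d ih =>
    obtain ⟨c, hc⟩ := hp
    obtain ⟨c', hc'⟩ := ih (hc o)
    refine ⟨c' + if d + 1 = e then c else 0, ?_⟩
    rw [h.compress_succ ho d e p c, hc']
    split_ifs <;> simp

theorem compress_isPoly_of_lt {o o' : ι} (ho : o ≠ o') {d : ℕ} {p : A} (hp : IsPoly K y d p)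
    {e : ℕ} (he : d < e) : y o' * y o ^ d * p * (x o ^ e * x o') = 0 := by
  induction d generalizing p with
  | zero =>
    obtain ⟨c, rfl⟩ := hp
    rw [← Algebra.commutes, mul_assoc, h.y_mul_pow_mul_pow_mul_x ho, if_neg he.ne, mul_zero]
  | succ d ih =>
    obtain ⟨c, hc⟩ := hp
    rw [h.compress_succ ho d e p c, ih (hc o) (by omega), if_neg he.ne, add_zero]

/-- The centre of an algebra generated by a Leavitt family consists of the scalars. -/
theorem exists_eq_algebraMap_of_central [Nontrivial ι]
    (hgen : Algebra.adjoin K (Set.range x ∪ Set.range y) = ⊤) {z : A}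
    (hz : ∀ a, a * z = z * a) : ∃ c : K, z = algebraMap K A c := by
  obtain ⟨o, o', ho⟩ := exists_pair_ne ι
  obtain ⟨k, hk⟩ := h.exists_isPolyAfter hgen z
  obtain ⟨d, hd⟩ := hk.mul_x_pow o
  obtain ⟨c, hc⟩ := h.compress_isPoly ho (hd.add_right k) d
  refine ⟨c, hc ▸ ?_⟩
  have : y o' * y o ^ (d + k) * (z * x o ^ k) * (x o ^ d * x o') =
      y o' * y o ^ (d + k) * z * (x o ^ (d + k) * x o') := by
    rw [add_comm d k, pow_add (x o)]; noncomm_ring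
  rw [this, hz, mul_assoc, h.y_mul_pow_mul_pow_mul_x ho, if_pos rfl, mul_one]

theorem exists_mul_mul_eq_one_of_isPoly [Nontrivial ι] {d : ℕ} {p : A} (hp : IsPoly K y d p)
    (hp0 : p ≠ 0) : ∃ b c : A, b * p * c = 1 := by
  obtain ⟨o, o', ho⟩ := exists_pair_ne ι
  have inv {c : K} (hc : c ≠ 0) : algebraMap K A c⁻¹ * algebraMap K A c = 1 := by
    rw [← map_mul, inv_mul_cancel₀ hc, map_one]
  induction d generalizing p with
  | zero =>
    obtain ⟨c, rfl⟩ := hp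
    have hc : c ≠ 0 := by rintro rfl; simp at hp0
    exact ⟨algebraMap K A c⁻¹, 1, by rw [mul_one, inv hc]⟩
  | succ d ih =>
    obtain ⟨c, hc⟩ := hp
    by_cases hc0 : c = 0
    · obtain ⟨i, hi⟩ : ∃ i, y i * p ≠ 0 := by
        by_contra! H
        exact hp0 (h.eq_zero_of_y_mul H)
      obtain ⟨b, b', hb⟩ := ih (by simpa [hc0] using hc i) hi
      exact ⟨b * y i, b', by rw [← hb]; noncomm_ring⟩
    · -- compression by a word of length greater than the degree leaves only the constant term
      refine ⟨algebraMap K A c⁻¹ * (y o' * y o ^ (d + 1)), x o ^ (d + 1) * x o', ?_⟩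
      rw [mul_assoc, mul_assoc, ← mul_assoc _ p, h.compress_succ ho d (d + 1) p c,
        h.compress_isPoly_of_lt ho (hc o) (Nat.lt_succ_self d), if_pos rfl, zero_add, inv hc0]

/-- An algebra generated by a Leavitt family is purely infinite simple. -/
theorem exists_mul_mul_eq_one [Nontrivial ι]
    (hgen : Algebra.adjoin K (Set.range x ∪ Set.range y) = ⊤) {a : A} (ha : a ≠ 0) :
    ∃ b c : A, b * a * c = 1 := by
  obtain ⟨k, hk⟩ := h.exists_isPolyAfter hgen a
  induction k generalizing a with
  | zero => obtain ⟨d, hd⟩ := hk; exact h.exists_mul_mul_eq_one_of_isPoly hd ha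
  | succ k ih =>
    obtain ⟨i, hi⟩ : ∃ i, a * x i ≠ 0 := by
      by_contra! H
      exact ha (h.eq_zero_of_mul_x H)
    obtain ⟨b, c, hbc⟩ := ih hi (hk i)
    exact ⟨b, x i * c, by rw [← hbc]; noncomm_ring⟩

end Poly

/-! ### Lie ideals of the commutator space -/

section Lie

variable {K ι A : Type*} [Fintype ι] [DecidableEq ι] [Field K] [Ring A] [Algebra K A]
  {x y : ι → A}

/-- The products of two members of a Leavitt family form a Leavitt family. -/
theorem prod (h : IsLeavittFamily x y) :
    IsLeavittFamily (fun p : ι × ι => x p.1 * x p.2) (fun p => y p.2 * y p.1) where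
  y_mul_x p q := by
    have : y p.2 * y p.1 * (x q.1 * x q.2) = y p.2 * (y p.1 * x q.1) * x q.2 := by noncomm_ring
    rw [this, h.y_mul_x]
    by_cases h1 : p.1 = q.1 <;> simp [h1, h.y_mul_x, Prod.ext_iff]
  sum_x_mul_y := by
    rw [Fintype.sum_prod_type, ← h.sum_x_mul_y]
    refine Finset.sum_congr rfl fun i _ => ?_
    have (j : ι) : x i * x j * (y j * y i) = x i * (x j * y j) * y i := by noncomm_ring
    simp only [this]
    rw [← Finset.sum_mul, ← Finset.mul_sum, h.sum_x_mul_y, mul_one]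

theorem eq_sum_sum (h : IsLeavittFamily x y) (a : A) :
    a = ∑ i, ∑ j, x i * (y i * a * x j) * y j := by
  have (i j : ι) : x i * (y i * a * x j) * y j = x i * y i * a * (x j * y j) := by noncomm_ring
  simp only [this]
  simp only [← Finset.mul_sum, ← Finset.sum_mul, h.sum_x_mul_y, one_mul, mul_one]

theorem unit_mul_unit (h : IsLeavittFamily x y) (i j k l : ι) (r s : A) :
    x i * r * y j * (x k * s * y l) = if j = k then x i * (r * s) * y l else 0 := by
  have : x i * r * y j * (x k * s * y l) = x i * r * (y j * x k) * s * y l := by noncomm_ring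
  rw [this, h.y_mul_x]
  split_ifs <;> simp [mul_assoc]

theorem entry_unit (h : IsLeavittFamily x y) (i j : ι) (r : A) :
    y i * (x i * r * y j) * x j = r := by
  have : y i * (x i * r * y j) * x j = (y i * x i) * r * (y j * x j) := by noncomm_ring
  rw [this, h.y_mul_x, h.y_mul_x]
  simp

variable (K A) in
/-- The `K`-span of all commutators `a * b - b * a`. -/
def commutatorSpan : Submodule K A := Submodule.span K {c | ∃ a b : A, a * b - b * a = c}

theorem commutator_mem (a b : A) : a * b - b * a ∈ commutatorSpan K A :=
  Submodule.subset_span ⟨a, b, rfl⟩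

theorem unit_mem_commutatorSpan (h : IsLeavittFamily x y) {i j : ι} (hij : i ≠ j) (r : A) :
    x i * r * y j ∈ commutatorSpan K A := by
  have := commutator_mem (K := K) (x i * 1 * y i) (x i * r * y j)
  rwa [h.unit_mul_unit, h.unit_mul_unit, if_pos rfl, if_neg hij.symm, sub_zero, one_mul] at this

variable {U : Submodule K A}

/-- If `[[A, A], U] ⊆ U` and `U` contains all `x i * r * y j` for one pair `i ≠ j`, then it
contains them for all pairs, provided that there are at least three indices. -/
theorem unit_mem_of_unit_mem (h : IsLeavittFamily x y) (h3 : ∀ i j : ι, ∃ k, k ≠ i ∧ k ≠ j)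
    (hU : ∀ s ∈ commutatorSpan K A, ∀ u ∈ U, s * u - u * s ∈ U) {i j : ι} (hij : i ≠ j)
    (hmem : ∀ r, x i * r * y j ∈ U) {k l : ι} (hkl : k ≠ l) (r : A) : x k * r * y l ∈ U := by
  have right {i j l : ι} (hij : i ≠ j) (hil : i ≠ l) (hmem : ∀ r, x i * r * y j ∈ U) (r : A) :
      x i * r * y l ∈ U := by
    by_cases hjl : j = l
    · exact hjl ▸ hmem r
    have := hU _ (h.unit_mem_commutatorSpan hjl r) _ (hmem 1)
    rw [h.unit_mul_unit, h.unit_mul_unit, if_neg hil.symm, if_pos rfl, zero_sub, one_mul] at this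
    exact neg_mem_iff.1 this
  have left {i j k : ι} (hij : i ≠ j) (hkj : k ≠ j) (hmem : ∀ r, x i * r * y j ∈ U) (r : A) :
      x k * r * y j ∈ U := by
    by_cases hki : k = i
    · exact hki ▸ hmem r
    have := hU _ (h.unit_mem_commutatorSpan hki r) _ (hmem 1)
    rwa [h.unit_mul_unit, h.unit_mul_unit, if_neg hkj.symm, if_pos rfl, sub_zero, mul_one] at this
  obtain ⟨m, hmi, hmk⟩ := h3 i k
  exact right hmk.symm hkl (left hmi.symm hmk.symm (right hij hmi.symm hmem)) r

/-- The off-diagonal matrix units and their brackets span `[A, A]`. -/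
theorem commutatorSpan_le (h : IsLeavittFamily x y) (h3 : ∀ i j : ι, ∃ k, k ≠ i ∧ k ≠ j)
    (hU : ∀ s ∈ commutatorSpan K A, ∀ u ∈ U, s * u - u * s ∈ U)
    (hmem : ∀ i j, i ≠ j → ∀ r, x i * r * y j ∈ U) : commutatorSpan K A ≤ U := by
  have diag {i j : ι} (hij : i ≠ j) (r s : A) :
      x i * (r * s) * y i - x j * (s * r) * y j ∈ U := by
    have := hU _ (h.unit_mem_commutatorSpan hij r) _ (hmem j i hij.symm s)
    rwa [h.unit_mul_unit, h.unit_mul_unit, if_pos rfl, if_pos rfl] at this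
  have key (i j k l : ι) (r s : A) :
      x i * r * y j * (x k * s * y l) - x k * s * y l * (x i * r * y j) ∈ U := by
    rw [h.unit_mul_unit, h.unit_mul_unit]
    by_cases hjk : j = k <;> by_cases hli : l = i
    · subst hjk hli
      rw [if_pos rfl, if_pos rfl]
      by_cases hlj : l = j
      · subst hlj
        obtain ⟨m, hm, -⟩ := h3 l l
        convert sub_mem (diag hm.symm r s) (diag hm.symm (s * r) 1) using 1
        rw [mul_one, one_mul]
        abel
      · exact diag hlj r s
    · rw [if_pos hjk, if_neg hli, sub_zero]
      exact hmem _ _ (Ne.symm hli) _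
    · rw [if_neg hjk, if_pos hli, zero_sub]
      exact neg_mem (hmem _ _ (Ne.symm hjk) _)
    · simp [hjk, hli]
  rw [commutatorSpan, Submodule.span_le]
  rintro _ ⟨a, b, rfl⟩
  have one_side (i j : ι) (r : A) : x i * r * y j * b - b * (x i * r * y j) ∈ U := by
    rw [h.eq_sum_sum b]
    simp only [Finset.sum_mul, Finset.mul_sum, ← Finset.sum_sub_distrib]
    exact sum_mem fun k _ => sum_mem fun l _ => key _ _ _ _ _ _
  rw [h.eq_sum_sum a]
  simp only [Finset.sum_mul, Finset.mul_sum, ← Finset.sum_sub_distrib]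
  exact sum_mem fun i _ => sum_mem fun j _ => one_side _ _ _

/-- An element of `U` with a nonzero off-diagonal entry forces `U` to contain all off-diagonal
matrix units, hence `[A, A]`: double brackets with matrix units isolate that entry, and it
generates the whole algebra as a two-sided ideal. -/
theorem commutatorSpan_le_of_entry_ne_zero (h : IsLeavittFamily x y)
    (h3 : ∀ i j : ι, ∃ k, k ≠ i ∧ k ≠ j)
    (hinf : ∀ a : A, a ≠ 0 → ∃ b c : A, b * a * c = 1)
    (hU : ∀ s ∈ commutatorSpan K A, ∀ u ∈ U, s * u - u * s ∈ U) {u : A} (hu : u ∈ U) {j p : ι}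
    (hjp : j ≠ p) (hne : y j * u * x p ≠ 0) : commutatorSpan K A ≤ U := by
  obtain ⟨i, hij, hip⟩ := h3 j p
  obtain ⟨b, c, hbc⟩ := hinf _ hne
  -- `[x i * y j, [x p * y j, u]]` has only the two entries `(i, j)` and `(p, j)`
  have h1 : x i * (y j * u * x p) * y j + x p * (y j * u * x i) * y j ∈ U := by
    have := neg_mem (hU _ (h.unit_mem_commutatorSpan hij 1) _
      (hU _ (h.unit_mem_commutatorSpan hjp.symm 1) _ hu))
    convert this using 1
    have e1 : y j * x p = 0 := by rw [h.y_mul_x, if_neg hjp]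
    have e2 : y j * x i = 0 := by rw [h.y_mul_x, if_neg hij.symm]
    have e3 : x i * 1 * y j * (x p * 1 * y j * u) = x i * (y j * x p) * y j * u := by
      noncomm_ring
    have e4 : u * (x p * 1 * y j) * (x i * 1 * y j) = u * x p * (y j * x i) * y j := by
      noncomm_ring
    rw [mul_sub, sub_mul, e3, e4, e1, e2]
    noncomm_ring
  -- multiplying by `x p * r * y i` on the left isolates the entry `y j * u * x p`
  have h2 (r : A) : x p * (r * (y j * u * x p)) * y j ∈ U := by
    have := hU _ (h.unit_mem_commutatorSpan hip.symm r) _ h1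
    rw [mul_add, add_mul] at this
    simp only [h.unit_mul_unit] at this
    simpa [hij, hij.symm, hip, hip.symm, hjp, hjp.symm] using this
  have h3' (r : A) : x p * r * y i ∈ U := by
    have := neg_mem (hU _ (h.unit_mem_commutatorSpan hij.symm c) _ (h2 (r * b)))
    simp only [h.unit_mul_unit, if_neg hip, if_true, zero_sub, neg_neg] at this
    rwa [show r * b * (y j * u * x p) * c = r * (b * (y j * u * x p) * c) by noncomm_ring, hbc,
      mul_one] at this
  exact h.commutatorSpan_le h3 hU fun k l hkl r => h.unit_mem_of_unit_mem h3 hU hip.symm h3' hkl r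

/-- Herstein's theorem for purely infinite simple central algebras with at least three matrix
units: if the commutator space does not contain `1`, then it has no proper nonzero Lie ideals. -/
theorem commutatorSpan_le_of_lieIdeal (h : IsLeavittFamily x y)
    (h3 : ∀ i j : ι, ∃ k, k ≠ i ∧ k ≠ j)
    (hinf : ∀ a : A, a ≠ 0 → ∃ b c : A, b * a * c = 1)
    (hcent : ∀ z : A, (∀ a, a * z = z * a) → ∃ c : K, z = algebraMap K A c)
    (h1 : (1 : A) ∉ commutatorSpan K A) (hUS : U ≤ commutatorSpan K A)
    (hU : ∀ s ∈ commutatorSpan K A, ∀ u ∈ U, s * u - u * s ∈ U) (hU0 : U ≠ ⊥) :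
    commutatorSpan K A ≤ U := by
  obtain ⟨u, hu, hu0⟩ := U.ne_bot_iff.1 hU0
  by_contra hle
  have offdiag {v : A} (hv : v ∈ U) {j p : ι} (hjp : j ≠ p) : y j * v * x p = 0 := by
    by_contra hne
    exact hle (h.commutatorSpan_le_of_entry_ne_zero h3 hinf hU hv hjp hne)
  have hux (p : ι) : u * x p = x p * (y p * u * x p) := by
    rw [h.eq_sum_mul (u * x p), Finset.sum_eq_single p, mul_assoc (y p)]
    · intro j _ hjp
      rw [← mul_assoc (y j), offdiag hu hjp, mul_zero]
    · simp
  have hyu (p : ι) : y p * u = y p * u * x p * y p := by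
    conv_lhs => rw [← mul_one (y p * u), ← h.sum_x_mul_y, Finset.mul_sum]
    rw [Finset.sum_eq_single p, ← mul_assoc]
    · intro j _ hjp
      rw [← mul_assoc, offdiag hu hjp.symm, zero_mul]
    · simp
  -- the diagonal entries of `u` agree and commute with everything
  have hcomm {i j : ι} (hij : i ≠ j) (r : A) : r * (y j * u * x j) = y i * u * x i * r := by
    have := offdiag (hU _ (h.unit_mem_commutatorSpan hij r) _ hu) hij
    have e : x i * r * y j * u - u * (x i * r * y j) =
        x i * (r * (y j * u * x j) - y i * u * x i * r) * y j := by
      have e1 : x i * r * y j * u = x i * r * (y j * u) := by noncomm_ring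
      have e2 : u * (x i * r * y j) = u * x i * r * y j := by noncomm_ring
      have hj := hyu j
      have hi := hux i
      generalize y j * u * x j = b at hj ⊢
      generalize y i * u * x i = c at hi ⊢
      rw [e1, e2, hj, hi]
      noncomm_ring
    rw [e, h.entry_unit] at this
    exact sub_eq_zero.1 this
  have hdiag (i j : ι) : y i * u * x i = y j * u * x j := by
    by_cases hij : i = j
    · rw [hij]
    · simpa using (hcomm hij 1).symm
  obtain ⟨i⟩ : Nonempty ι := by
    by_contra hne
    rw [not_nonempty_iff] at hne
    exact hu0 (h.eq_zero_of_y_mul fun i => hne.elim i)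
  obtain ⟨k, hki, -⟩ := h3 i i
  obtain ⟨c, hc⟩ := hcent (y i * u * x i) fun a => by rw [hcomm hki a, hdiag]
  have huc : u = algebraMap K A c := by
    rw [h.eq_sum_mul u]
    calc ∑ j, x j * (y j * u) = ∑ j, algebraMap K A c * (x j * y j) := by
          refine Finset.sum_congr rfl fun j _ => ?_
          rw [hyu, hdiag j i, hc, ← mul_assoc, ← mul_assoc, Algebra.commutes]
      _ = algebraMap K A c := by rw [← Finset.mul_sum, h.sum_x_mul_y, mul_one]
  have hc0 : c ≠ 0 := by rintro rfl; simp [huc] at hu0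
  refine h1 (hUS ?_)
  have := U.smul_mem c⁻¹ hu
  rwa [huc, Algebra.algebraMap_eq_smul_one, smul_smul, inv_mul_cancel₀ hc0, one_smul] at this

end Lie
end IsLeavittFamily

/-! ### The trace on the Cohn algebra -/

namespace CohnAlgebra

variable (K : Type*) [Field K] {n : ℕ}

theorem y_mul_x (i j : Fin n) : y K i * x K j = if i = j then 1 else 0 := by
  rw [x, y, ← map_mul]
  split_ifs with hij
  · subst hij
    rw [RingQuot.mkAlgHom_rel K (CohnRel.same i), map_one]
  · rw [RingQuot.mkAlgHom_rel K (CohnRel.diff i j hij), map_zero]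

theorem adjoin_eq_top :
    Algebra.adjoin K (Set.range (x K (n := n)) ∪ Set.range (y K)) = ⊤ := by
  have h := congrArg (Subalgebra.map (RingQuot.mkAlgHom K (CohnRel K n)))
    (FreeAlgebra.adjoin_range_ι K (CohnGen n))
  rw [AlgHom.map_adjoin, Algebra.map_top,
    (AlgHom.range_eq_top _).2 (RingQuot.mkAlgHom_surjective K _)] at h
  rw [← h]
  congr 1
  ext a
  constructor
  · rintro (⟨i, rfl⟩ | ⟨i, rfl⟩)
    exacts [⟨_, ⟨_, rfl⟩, rfl⟩, ⟨_, ⟨_, rfl⟩, rfl⟩]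
  · rintro ⟨_, ⟨i | i, rfl⟩, rfl⟩
    exacts [Or.inl ⟨i, rfl⟩, Or.inr ⟨i, rfl⟩]

variable (n)

/-- The normal-form module of the Cohn algebra. The basis vector
`([i₁, …, iₖ], [j₁, …, jₗ])` stands for the monomial `x i₁ * ⋯ * x iₖ * y jₗ * ⋯ * y j₁`: the heads
of the two lists are the outermost factors. -/
abbrev NormalForm : Type _ := (List (Fin n) × List (Fin n)) →₀ K

variable {n}

open Finsupp in
/-- Left multiplication by `x i` on normal forms. -/
noncomputable def leftX (i : Fin n) : NormalForm K n →ₗ[K] NormalForm K n :=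
  linearCombination K fun p => single (i :: p.1, p.2) 1

open Finsupp in
/-- Left multiplication by `y i` on normal forms. -/
noncomputable def leftY (i : Fin n) : NormalForm K n →ₗ[K] NormalForm K n :=
  linearCombination K fun p => match p with
    | ([], J) => single ([], J ++ [i]) 1
    | (j :: I, J) => if i = j then single (I, J) 1 else 0

open Finsupp in
/-- Right multiplication by `y i` on normal forms. -/
noncomputable def rightY (i : Fin n) : NormalForm K n →ₗ[K] NormalForm K n :=
  linearCombination K fun p => single (p.1, i :: p.2) 1

open Finsupp in
/-- Right multiplication by `x i` on normal forms. -/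
noncomputable def rightX (i : Fin n) : NormalForm K n →ₗ[K] NormalForm K n :=
  linearCombination K fun p => match p with
    | (I, []) => single (I ++ [i], []) 1
    | (I, j :: J) => if i = j then single (I, J) 1 else 0

/-- The functional on normal forms sending `(I, J)` to `1` if `I = J` and to `0` otherwise. -/
noncomputable def normalTrace : NormalForm K n →ₗ[K] K :=
  Finsupp.linearCombination K fun p => if p.1 = p.2 then 1 else 0

theorem leftY_leftX (i j : Fin n) (v : NormalForm K n) :
    leftY K i (leftX K j v) = if i = j then v else 0 := by
  suffices H : leftY K i ∘ₗ leftX K j = if i = j then LinearMap.id else 0 by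
    have := LinearMap.congr_fun H v
    split_ifs at this ⊢ <;> simpa using this
  ext p : 2
  split_ifs with hij <;> simp [leftX, leftY, hij]

/-- The left regular representation of the Cohn algebra, in terms of normal forms. -/
noncomputable def normalRep : CohnAlgebra K n →ₐ[K] Module.End K (NormalForm K n) :=
  RingQuot.liftAlgHom K ⟨FreeAlgebra.lift K fun g => match g with
    | CohnGen.x i => leftX K i
    | CohnGen.y i => leftY K i, by
      intro a b hab
      cases hab with
      | same i => ext1 p; ext1; simp [leftY_leftX]
      | diff i j hij => ext1 p; ext1; simp [leftY_leftX, hij]⟩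

theorem normalRep_x (i : Fin n) : normalRep K (x K i) = leftX K i := by
  rw [normalRep, x, RingQuot.liftAlgHom_mkAlgHom_apply]
  simp

theorem normalRep_y (i : Fin n) : normalRep K (y K i) = leftY K i := by
  rw [normalRep, y, RingQuot.liftAlgHom_mkAlgHom_apply]
  simp

theorem leftX_rightX (i j : Fin n) : leftX K i ∘ₗ rightX K j = rightX K j ∘ₗ leftX K i := by
  ext ⟨I, J⟩ : 2
  cases J with
  | nil => simp [leftX, rightX]
  | cons k J => by_cases hk : j = k <;> simp [leftX, rightX, hk]

theorem leftX_rightY (i j : Fin n) : leftX K i ∘ₗ rightY K j = rightY K j ∘ₗ leftX K i := by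
  ext ⟨I, J⟩ : 2
  simp [leftX, rightY]

theorem leftY_rightX (i j : Fin n) : leftY K i ∘ₗ rightX K j = rightX K j ∘ₗ leftY K i := by
  ext ⟨I, J⟩ : 2
  cases I with
  | nil =>
    cases J with
    | nil => by_cases hij : i = j <;> simp [leftY, rightX, hij, eq_comm]
    | cons l J => by_cases hl : j = l <;> simp [leftY, rightX, hl]
  | cons k I =>
    cases J with
    | nil => by_cases hk : i = k <;> simp [leftY, rightX, hk]
    | cons l J =>
      by_cases hk : i = k <;> by_cases hl : j = l <;> simp [leftY, rightX, hk, hl]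

theorem leftY_rightY (i j : Fin n) : leftY K i ∘ₗ rightY K j = rightY K j ∘ₗ leftY K i := by
  ext ⟨I, J⟩ : 2
  cases I with
  | nil => simp [leftY, rightY]
  | cons k I => by_cases hk : i = k <;> simp [leftY, rightY, hk]

theorem normalRep_comp_right (a : CohnAlgebra K n) (i : Fin n) :
    normalRep K a ∘ₗ rightX K i = rightX K i ∘ₗ normalRep K a ∧
      normalRep K a ∘ₗ rightY K i = rightY K i ∘ₗ normalRep K a := by
  have ha : a ∈ Algebra.adjoin K (Set.range (x K (n := n)) ∪ Set.range (y K)) :=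
    adjoin_eq_top K ▸ Algebra.mem_top
  induction ha using Algebra.adjoin_induction with
  | mem a ha =>
    rcases ha with ⟨j, rfl⟩ | ⟨j, rfl⟩
    · rw [normalRep_x]; exact ⟨leftX_rightX K j i, leftX_rightY K j i⟩
    · rw [normalRep_y]; exact ⟨leftY_rightX K j i, leftY_rightY K j i⟩
  | algebraMap r =>
    simp [Module.algebraMap_end_eq_smul_id, LinearMap.smul_comp, LinearMap.comp_smul]
  | add a b _ _ iha ihb =>
    simp only [map_add, LinearMap.add_comp, LinearMap.comp_add, iha, ihb, and_self]
  | mul a b _ _ iha ihb =>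
    simp only [map_mul, Module.End.mul_eq_comp, LinearMap.comp_assoc, ihb]
    simp only [← LinearMap.comp_assoc, iha, and_self]

/-- The trace of the Cohn algebra: `x_I y_J` goes to `1` if it is a diagonal monomial, that is, if
`y_J x_I = 1`, and to `0` otherwise. -/
noncomputable def cohnTrace : CohnAlgebra K n →ₗ[K] K :=
  normalTrace K ∘ₗ LinearMap.applyₗ (Finsupp.single ([], []) 1) ∘ₗ (normalRep K).toLinearMap

theorem cohnTrace_apply (a : CohnAlgebra K n) :
    cohnTrace K a = normalTrace K (normalRep K a (Finsupp.single ([], []) 1)) := rfl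

theorem cohnTrace_one : cohnTrace K (1 : CohnAlgebra K n) = 1 := by
  simp [cohnTrace_apply, normalTrace]

theorem normalTrace_leftX (i : Fin n) :
    normalTrace K ∘ₗ leftX K i = normalTrace K ∘ₗ rightX K i := by
  ext ⟨I, J⟩ : 2
  cases J with
  | nil => simp [normalTrace, leftX, rightX]
  | cons j J => by_cases h : i = j <;> simp [normalTrace, leftX, rightX, h]

theorem normalTrace_leftY (i : Fin n) :
    normalTrace K ∘ₗ leftY K i = normalTrace K ∘ₗ rightY K i := by
  ext ⟨I, J⟩ : 2
  cases I with
  | nil => simp [normalTrace, leftY, rightY]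
  | cons j I => by_cases h : i = j <;> simp [normalTrace, leftY, rightY, h, eq_comm]

theorem cohnTrace_mul_comm (a b : CohnAlgebra K n) :
    cohnTrace K (a * b) = cohnTrace K (b * a) := by
  have ha : a ∈ Algebra.adjoin K (Set.range (x K (n := n)) ∪ Set.range (y K)) :=
    adjoin_eq_top K ▸ Algebra.mem_top
  induction ha using Algebra.adjoin_induction generalizing b with
  | mem a ha =>
    have gen {l r : NormalForm K n →ₗ[K] NormalForm K n} (hl : normalRep K a = l)
        (hlr : normalTrace K ∘ₗ l = normalTrace K ∘ₗ r)
        (hr : normalRep K b ∘ₗ r = r ∘ₗ normalRep K b)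
        (he : l (Finsupp.single ([], []) 1) = r (Finsupp.single ([], []) 1)) :
        cohnTrace K (a * b) = cohnTrace K (b * a) := by
      rw [cohnTrace_apply, cohnTrace_apply, map_mul, map_mul, Module.End.mul_apply,
        Module.End.mul_apply, hl, he, ← LinearMap.comp_apply (normalTrace K), hlr,
        ← LinearMap.comp_apply (normalRep K b), hr]
      rfl
    rcases ha with ⟨i, rfl⟩ | ⟨i, rfl⟩
    · exact gen (normalRep_x K i) (normalTrace_leftX K i) (normalRep_comp_right K b i).1
        (by simp [leftX, rightX])
    · exact gen (normalRep_y K i) (normalTrace_leftY K i) (normalRep_comp_right K b i).2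
        (by simp [leftY, rightY])
  | algebraMap r => rw [Algebra.commutes]
  | add a a' _ _ iha iha' => rw [add_mul, mul_add, map_add, map_add, iha, iha']
  | mul a a' _ _ iha iha' => rw [mul_assoc, iha, mul_assoc, iha', mul_assoc]

/-- If `n = 1` in `K`, then `1 - ∑ i, x i * y i` is orthogonal to the whole algebra for the trace
form: `x_I y_J` and `∑ i, x_I x_i y_i y_J` have the same trace. -/
theorem cohnTrace_sum_mul (hn : (n : K) = 1) (c : CohnAlgebra K n) :
    cohnTrace K ((1 - ∑ i, x K i * y K i) * c) = 0 := by
  have H : normalTrace K ∘ₗ (∑ i : Fin n, leftX K i ∘ₗ leftY K i) = normalTrace K := by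
    ext ⟨I, J⟩ : 2
    cases I with
    | nil =>
      cases J with
      | nil => simp [normalTrace, leftX, leftY, hn]
      | cons j J => simp [normalTrace, leftX, leftY]
    | cons j I => simp [normalTrace, leftX, leftY, apply_ite]
  rw [cohnTrace_apply]
  simp only [map_mul, map_sub, map_one, map_sum, normalRep_x, normalRep_y, Module.End.mul_apply,
    LinearMap.sub_apply, Module.End.one_apply]
  rw [sub_eq_zero]
  exact (LinearMap.congr_fun H _).symm

end CohnAlgebra

/-! ### The Leavitt algebra -/

namespace LeavittAlgebra

open CohnAlgebra IsLeavittFamily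

variable (K : Type*) [Field K] {n : ℕ}

/-- The generator `x i` of the Leavitt algebra. -/
noncomputable def x (i : Fin n) : LeavittAlgebra K n :=
  RingQuot.mkAlgHom K (LeavittRel K n) (CohnAlgebra.x K i)

/-- The generator `y i` of the Leavitt algebra. -/
noncomputable def y (i : Fin n) : LeavittAlgebra K n :=
  RingQuot.mkAlgHom K (LeavittRel K n) (CohnAlgebra.y K i)

theorem isLeavittFamily : IsLeavittFamily (x K (n := n)) (y K) where
  y_mul_x i j := by
    rw [x, y, ← map_mul, CohnAlgebra.y_mul_x]
    split_ifs <;> simp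
  sum_x_mul_y := by
    have := RingQuot.mkAlgHom_rel K (LeavittRel.unit (K := K) (n := n))
    rw [map_sub, map_one, map_zero, map_sum, sub_eq_zero] at this
    simp only [x, y, ← map_mul]
    exact this.symm

theorem adjoin_eq_top :
    Algebra.adjoin K (Set.range (x K (n := n)) ∪ Set.range (y K)) = ⊤ := by
  have h := congrArg (Subalgebra.map (RingQuot.mkAlgHom K (LeavittRel K n)))
    (CohnAlgebra.adjoin_eq_top K (n := n))
  rw [AlgHom.map_adjoin, Algebra.map_top,
    (AlgHom.range_eq_top _).2 (RingQuot.mkAlgHom_surjective K _), Set.image_union,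
    ← Set.range_comp, ← Set.range_comp] at h
  exact h

/-- The left ideal of those elements of the Cohn algebra which are orthogonal to the whole algebra
for the trace form. -/
noncomputable def traceRadical (n : ℕ) : Submodule (CohnAlgebra K n) (CohnAlgebra K n) where
  carrier := {c | ∀ b, cohnTrace K (b * c) = 0}
  add_mem' ha hb c := by rw [mul_add, map_add, ha, hb, add_zero]
  zero_mem' b := by rw [mul_zero, map_zero]
  smul_mem' a c hc b := by rw [smul_eq_mul, ← mul_assoc, hc]

variable {K} in
theorem mem_traceRadical {c : CohnAlgebra K n} :
    c ∈ traceRadical K n ↔ ∀ b, cohnTrace K (b * c) = 0 := Iff.rfl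

theorem lsmul_eq_of_leavittRel (hn : (n : K) = 1) ⦃a b : CohnAlgebra K n⦄
    (hab : LeavittRel K n a b) :
    Algebra.lsmul K K (CohnAlgebra K n ⧸ traceRadical K n) a =
      Algebra.lsmul K K (CohnAlgebra K n ⧸ traceRadical K n) b := by
  cases hab
  refine LinearMap.ext fun m => ?_
  obtain ⟨c, rfl⟩ := Submodule.Quotient.mk_surjective _ m
  rw [Algebra.lsmul_coe, Algebra.lsmul_coe]
  beta_reduce
  rw [zero_smul, ← Submodule.Quotient.mk_smul,
    Submodule.Quotient.mk_eq_zero, mem_traceRadical]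
  intro b
  rw [cohnTrace_mul_comm, smul_eq_mul, mul_assoc, cohnTrace_sum_mul K hn]

/-- If `n = 1` in `K`, the trace vanishes on the kernel of the projection to the Leavitt algebra:
the action of the Cohn algebra on its quotient by the trace radical factors through the Leavitt
algebra. -/
theorem cohnTrace_eq_zero (hn : (n : K) = 1) {c : CohnAlgebra K n}
    (hc : RingQuot.mkAlgHom K (LeavittRel K n) c = 0) : cohnTrace K c = 0 := by
  have h1 : Algebra.lsmul K K (CohnAlgebra K n ⧸ traceRadical K n) c = 0 := by
    rw [← RingQuot.liftAlgHom_mkAlgHom_apply K _ (lsmul_eq_of_leavittRel K hn), hc, map_zero]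
  have h2 := LinearMap.congr_fun h1 (Submodule.Quotient.mk 1)
  rw [Algebra.lsmul_coe] at h2
  beta_reduce at h2
  rw [← Submodule.Quotient.mk_smul, LinearMap.zero_apply, Submodule.Quotient.mk_eq_zero,
    mem_traceRadical] at h2
  simpa using h2 1

/-- If `n = 1` in `K`, then `1` is not a sum of commutators in the Leavitt algebra: such a
decomposition lifts to the Cohn algebra modulo the kernel of the projection, where the trace
vanishes, while the trace of `1` is `1`. -/
theorem one_notMem_commutatorSpan (hn : (n : K) = 1) :
    (1 : LeavittAlgebra K n) ∉ commutatorSpan K (LeavittAlgebra K n) := by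
  intro h
  have lift {a : LeavittAlgebra K n} (ha : a ∈ commutatorSpan K (LeavittAlgebra K n)) :
      ∃ c, RingQuot.mkAlgHom K (LeavittRel K n) c = a ∧ cohnTrace K c = 0 := by
    induction ha using Submodule.span_induction with
    | mem a ha =>
      obtain ⟨b, c, rfl⟩ := ha
      obtain ⟨b, rfl⟩ := RingQuot.mkAlgHom_surjective K (LeavittRel K n) b
      obtain ⟨c, rfl⟩ := RingQuot.mkAlgHom_surjective K (LeavittRel K n) c
      exact ⟨b * c - c * b, by simp, by rw [map_sub, cohnTrace_mul_comm, sub_self]⟩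
    | zero => exact ⟨0, by simp, by simp⟩
    | add a b _ _ iha ihb =>
      obtain ⟨c, rfl, hc⟩ := iha
      obtain ⟨d, rfl, hd⟩ := ihb
      exact ⟨c + d, by simp, by simp [hc, hd]⟩
    | smul r a _ iha =>
      obtain ⟨c, rfl, hc⟩ := iha
      exact ⟨r • c, by simp, by simp [hc]⟩
  obtain ⟨c, hc, hc0⟩ := lift h
  have := cohnTrace_eq_zero K hn (c := c - 1) (by rw [map_sub, hc, map_one, sub_self])
  rw [map_sub, hc0, cohnTrace_one, zero_sub, neg_eq_zero] at this
  exact one_ne_zero this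

theorem mem_derivedLie_iff {a : LeavittAlgebra K n} :
    a ∈ derivedLie K n ↔ a ∈ commutatorSpan K (LeavittAlgebra K n) := by
  rw [← LieSubmodule.mem_toSubmodule, LieSubmodule.lieIdeal_oper_eq_linear_span']
  have : {m : LeavittAlgebra K n | ∃ a ∈ (⊤ : LieIdeal K (LeavittAlgebra K n)),
      ∃ b ∈ (⊤ : LieIdeal K (LeavittAlgebra K n)), ⁅a, b⁆ = m} =
      {c | ∃ a b : LeavittAlgebra K n, a * b - b * a = c} := by
    ext m
    simp only [LieSubmodule.mem_top, true_and, Set.mem_ofPred_eq]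
    rfl
  rw [this]
  rfl

/-- The sum of the commutators `[y i, x i]` is `n - 1`. -/
theorem one_mem_derivedLie (hn : ((n - 1 : ℕ) : K) ≠ 0) :
    (1 : LeavittAlgebra K n) ∈ derivedLie K n := by
  have h := isLeavittFamily K (n := n)
  rw [mem_derivedLie_iff]
  have h1 : ∑ i : Fin n, (y K i * x K i - x K i * y K i) = ((n - 1 : ℕ) : K) • 1 := by
    have hpos : 1 ≤ n := by
      by_contra hlt
      exact hn (by rw [show n - 1 = 0 by omega, Nat.cast_zero])
    rw [Finset.sum_sub_distrib, h.sum_x_mul_y]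
    simp [h.y_mul_x, Nat.cast_sub hpos, sub_smul, Nat.cast_smul_eq_nsmul]
  have h2 : ((n - 1 : ℕ) : K)⁻¹ • ∑ i : Fin n, (y K i * x K i - x K i * y K i) ∈
      commutatorSpan K (LeavittAlgebra K n) :=
    Submodule.smul_mem _ _ (sum_mem fun i _ => commutator_mem _ _)
  rwa [h1, smul_smul, inv_mul_cancel₀ hn, one_smul] at h2

end LeavittAlgebra

open LeavittAlgebra IsLeavittFamily in
theorem mainTheorem2 (K : Type*) [Field K] (n : ℕ) (hn : 2 ≤ n) :
    LieAlgebra.IsSimple K (LeavittAlgebra.derivedLie K n) ↔ ringChar K ∣ n - 1 := by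
  rw [← ringChar.spec]
  constructor
  · rintro ⟨hideal, hnonab⟩
    by_contra hne
    let z : derivedLie K n := ⟨1, one_mem_derivedLie K hne⟩
    have hz : z ∈ LieAlgebra.center K (derivedLie K n) := by
      rw [LieModule.mem_maxTrivSubmodule]
      intro w
      apply Subtype.ext
      change (w : LeavittAlgebra K n) * 1 - 1 * (w : LeavittAlgebra K n) = 0
      rw [mul_one, one_mul, sub_self]
    apply hnonab
    rcases hideal (LieAlgebra.center K (derivedLie K n)) with h | h
    · rw [h, LieSubmodule.mem_bot] at hz
      have h10 : (1 : LeavittAlgebra K n) = 0 := congrArg Subtype.val hz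
      have := subsingleton_of_zero_eq_one h10.symm
      exact ⟨fun a b => Subtype.ext (Subsingleton.elim _ _)⟩
    · exact (LieAlgebra.isLieAbelian_iff_center_eq_top K _).2 h
  · intro hdvd
    have hn1 : (n : K) = 1 := by
      rwa [Nat.cast_sub (by omega), Nat.cast_one, sub_eq_zero] at hdvd
    have h1 := one_notMem_commutatorSpan K hn1
    have h := isLeavittFamily K (n := n)
    have : Nontrivial (Fin n) := Fin.nontrivial_iff_two_le.2 hn
    refine ⟨fun I => or_iff_not_imp_left.2 fun hI => ?_, fun hab => ?_⟩
    · let U : Submodule K (LeavittAlgebra K n) :=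
        (I : Submodule K (derivedLie K n)).map (derivedLie K n).incl.toLinearMap
      have hle : commutatorSpan K (LeavittAlgebra K n) ≤ U := by
        refine h.prod.commutatorSpan_le_of_lieIdeal ?_ ?_ ?_ h1 ?_ ?_ ?_
        · intro i j
          -- there are `n ^ 2 ≥ 4` words of length two
          have hcard : ({i, j} : Finset (Fin n × Fin n)).card <
              Fintype.card (Fin n × Fin n) := by
            rw [Fintype.card_prod, Fintype.card_fin]
            have := Finset.card_le_two (a := i) (b := j)
            nlinarith
          obtain ⟨k, -, hk⟩ := Finset.exists_mem_notMem_of_card_lt_card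
            (s := {i, j}) (t := Finset.univ) hcard
          exact ⟨k, by simpa using hk⟩
        · exact fun a ha => h.exists_mul_mul_eq_one (LeavittAlgebra.adjoin_eq_top K) ha
        · exact fun z hz => h.exists_eq_algebraMap_of_central (LeavittAlgebra.adjoin_eq_top K) hz
        · rintro _ ⟨u, -, rfl⟩
          exact (mem_derivedLie_iff K).1 u.2
        · rintro s hs _ ⟨u, hu, rfl⟩
          exact ⟨⁅(⟨s, (mem_derivedLie_iff K).2 hs⟩ : derivedLie K n), u⁆,
            LieSubmodule.lie_mem _ hu, rfl⟩
        · intro hU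
          refine hI ((LieSubmodule.eq_bot_iff I).2 fun u hu => Subtype.ext ?_)
          exact (Submodule.mem_bot K).1 (hU ▸ Submodule.mem_map_of_mem hu)
      refine eq_top_iff.2 fun u _ => ?_
      obtain ⟨v, hv, hvu⟩ := hle ((mem_derivedLie_iff K).1 u.2)
      exact (Subtype.ext hvu : v = u) ▸ hv
    · -- `x o * y o'` and `x o' * y o` are commutators which do not commute
      obtain ⟨o, o', ho⟩ := exists_pair_ne (Fin n)
      have mem {i j : Fin n} (hij : i ≠ j) : LeavittAlgebra.x K i * 1 * LeavittAlgebra.y K j ∈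
          derivedLie K n :=
        (mem_derivedLie_iff K).2 (h.unit_mem_commutatorSpan hij 1)
      have hcomm : LeavittAlgebra.x K o * 1 * LeavittAlgebra.y K o' *
          (LeavittAlgebra.x K o' * 1 * LeavittAlgebra.y K o) -
          LeavittAlgebra.x K o' * 1 * LeavittAlgebra.y K o *
          (LeavittAlgebra.x K o * 1 * LeavittAlgebra.y K o') = 0 :=
        congrArg Subtype.val
          (hab.trivial (⟨_, mem ho⟩ : derivedLie K n) (⟨_, mem ho.symm⟩ : derivedLie K n))
      rw [h.unit_mul_unit, h.unit_mul_unit, if_pos rfl, if_pos rfl, sub_eq_zero] at hcomm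
      have h10 := h.entry_unit o o (1 * 1)
      rw [hcomm] at h10
      have : LeavittAlgebra.y K o * (LeavittAlgebra.x K o' * (1 * 1) * LeavittAlgebra.y K o') *
          LeavittAlgebra.x K o = 0 := by
        rw [← mul_assoc, ← mul_assoc, h.y_mul_x, if_neg ho]
        simp
      rw [this, mul_one] at h10
      exact h1 (h10 ▸ zero_mem _)
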